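/- Let $M\subset\mathbb{R}^m$ be an affine real algebraic variety, i.e. the common zero set of finitely many real polynomials (possibly singular, reducible or non-compact), of dimension $n$, i.e. the coordinate ring $\mathbb{R}[x_1,\dots,x_m]/I(M)$ has Krull dimension $n$, where $I(M)$ is the ideal of polynomials vanishing on $M$. For $k\ge 0$ let $H_k(M)$ be the real vector space of restrictions to $M$ of real polynomials of total degree at most $k$. Let $(\mu_k)$ be a sequence of finite measures on $M$ whose supports are all contained in one compact subset of $M$ and which are non-degenerate, i.e. $\|f\|_{L^2(\mu_k)}\neq 0$ for every $0\neq f\in H_k(M)$. Let $K_k(x,y)$ be the reproducing kernel of $H_k(M)$, viewed as a subspace of $L^2(M,\mu_k)$: $K_k(\cdot,x)\in H_k(M)$ and $f(x)=\int_M f(y)K_k(y,x)\,d\mu_k(y)$ for all $f\in H_k(M)$ and $x\in M$. Then there is a constant $C>0$ such that for every $k\ge 1$ the function $|K_k(x,y)|^2|x-y|^2$ is $\mu_k\otimes\mu_k$-integrable on $M\times M$ and $$\int_{M\times M}\frac{1}{k^{n}}\,|K_k(x,y)|^2\,|x-y|^2\,d\mu_k(x)\otimes d\mu_k(y)\le \frac{C}{k},$$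 where $|x-y|$ denotes the Euclidean distance in $\mathbb{R}^m$. -/

import Mathlib

open MeasureTheory

noncomputable section

/-- `M ⊆ ℝ^m` is an affine real algebraic variety: the common zero set of finitely many real
polynomials (not necessarily smooth, irreducible or compact). -/
def IsAffineRealVariety {m : ℕ} (M : Set (EuclideanSpace ℝ (Fin m))) : Prop :=
  ∃ P : Finset (MvPolynomial (Fin m) ℝ), M = {x | ∀ p ∈ P, MvPolynomial.eval x.ofLp p = 0}

/-- The coordinate ring `ℝ[x₁, …, x_m] / I(M)`, where `I(M)` is the ideal of all polynomials
vanishing on `M`. -/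
abbrev RealCoordinateRing {m : ℕ} (M : Set (EuclideanSpace ℝ (Fin m))) : Type :=
  MvPolynomial (Fin m) ℝ ⧸ MvPolynomial.vanishingIdeal ℝ (WithLp.ofLp '' M)

/-- `M` has dimension `n`: its coordinate ring has Krull dimension `n`. -/
def HasVarietyDim {m : ℕ} (M : Set (EuclideanSpace ℝ (Fin m))) (n : ℕ) : Prop :=
  ringKrullDim (RealCoordinateRing M) = n

/-- Restriction of polynomials on `ℝ^m` to functions on `M`. -/
def restrictPoly {m : ℕ} (M : Set (EuclideanSpace ℝ (Fin m))) :
    MvPolynomial (Fin m) ℝ →ₗ[ℝ] (M → ℝ) where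
  toFun p := fun x => MvPolynomial.eval x.1.ofLp p
  map_add' p q := by ext x; simp
  map_smul' c p := by ext x; simp

/-- `H_k(M)`: the real vector space of restrictions to `M` of real polynomials of total degree
at most `k`. -/
def polySpace {m : ℕ} (M : Set (EuclideanSpace ℝ (Fin m))) (k : ℕ) : Submodule ℝ (M → ℝ) :=
  (MvPolynomial.restrictTotalDegree (Fin m) ℝ k).map (restrictPoly M)

/-- `μ` is non-degenerate on the space of functions `H`: nonzero elements of `H` have nonzero
`L²(μ)`-norm. -/
def IsNondegenerateOn {X : Type*} [MeasurableSpace X] (H : Submodule ℝ (X → ℝ))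
    (μ : Measure X) : Prop :=
  ∀ f ∈ H, f ≠ 0 → eLpNorm f 2 μ ≠ 0

/-- `K` is the reproducing kernel of `H`, viewed as a subspace of `L²(X, μ)`: each `K(·, x)` lies
in `H`, and `f(x) = ⟨f, K(·, x)⟩` for all `f ∈ H` and all `x`. -/
def IsReproducingKernel {X : Type*} [MeasurableSpace X] (H : Submodule ℝ (X → ℝ))
    (μ : Measure X) (K : X → X → ℝ) : Prop :=
  (∀ x, (fun y => K y x) ∈ H) ∧ ∀ f ∈ H, ∀ x, f x = ∫ y, f y * K y x ∂μ

/-- The reproducing kernel of `H ⊆ L²(X, μ)`; see `existsUnique_isReproducingKernel` for its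
existence and uniqueness. -/
def reproducingKernel {X : Type*} [MeasurableSpace X] (H : Submodule ℝ (X → ℝ))
    (μ : Measure X) : X → X → ℝ :=
  Classical.epsilon (IsReproducingKernel H μ)

/-- A finite-dimensional space `H` of square integrable functions, on which `μ` is non-degenerate,
has exactly one reproducing kernel. -/
theorem existsUnique_isReproducingKernel {X : Type*} [MeasurableSpace X]
    (H : Submodule ℝ (X → ℝ)) [FiniteDimensional ℝ H] (μ : Measure X)
    (hL : ∀ f ∈ H, MemLp f 2 μ) (hnd : IsNondegenerateOn H μ) :
    ∃! K, IsReproducingKernel H μ K := by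
  have hint : ∀ f ∈ H, ∀ g ∈ H, Integrable (fun y => f y * g y) μ :=
    fun f hf g hg => (hL f hf).integrable_mul (hL g hg)
  have hdef : ∀ f ∈ H, (∫ y, f y * f y ∂μ) = 0 → f = 0 := by
    intro f hf h0
    by_contra hne
    refine hnd f hf hne ?_
    rw [integral_eq_zero_iff_of_nonneg (fun y => mul_self_nonneg (f y)) (hint f hf f hf)] at h0
    rw [eLpNorm_eq_zero_iff (hL f hf).1 two_ne_zero]
    filter_upwards [h0] with y hy
    simpa using hy
  let B : H →ₗ[ℝ] (H →ₗ[ℝ] ℝ) := LinearMap.mk₂ ℝ (fun g f : H => ∫ y, f.1 y * g.1 y ∂μ)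
    (by
      intro g g' f
      rw [← integral_add (hint _ f.2 _ g.2) (hint _ f.2 _ g'.2)]
      simp [mul_add])
    (by
      intro c g f
      rw [smul_eq_mul, ← integral_const_mul]
      congr 1; ext y; simp; ring)
    (by
      intro g f f'
      rw [← integral_add (hint _ f.2 _ g.2) (hint _ f'.2 _ g.2)]
      simp [add_mul])
    (by
      intro c g f
      rw [smul_eq_mul, ← integral_const_mul]
      congr 1; ext y; simp; ring)
  have hB : ∀ g f : H, B g f = ∫ y, f.1 y * g.1 y ∂μ := fun _ _ => rfl
  have hinj : Function.Injective B := by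
    rw [injective_iff_map_eq_zero]
    intro g hg
    apply Subtype.ext
    apply hdef g.1 g.2
    rw [← hB, hg]; rfl
  have hsurj : Function.Surjective B :=
    (LinearMap.injective_iff_surjective_of_finrank_eq_finrank
      (Subspace.dual_finrank_eq (K := ℝ) (V := H)).symm).1 hinj
  let ev : X → (H →ₗ[ℝ] ℝ) := fun x => (LinearMap.proj x).comp H.subtype
  choose R hR using fun x => hsurj (ev x)
  refine ⟨fun y x => (R x).1 y, ⟨fun x => (R x).2, fun f hf x => ?_⟩, ?_⟩
  · have h := congrArg (fun l => l ⟨f, hf⟩) (hR x)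
    simp only [hB] at h
    exact h.symm
  · rintro K' ⟨h1, h2⟩
    funext y x
    have : (⟨fun y => K' y x, h1 x⟩ : H) = R x := by
      apply hinj
      rw [hR]
      ext f
      rw [hB]
      exact (h2 f.1 f.2 x).symm
    exact congrFun (congrArg Subtype.val this) y

theorem reproducingKernel_spec {X : Type*} [MeasurableSpace X]
    (H : Submodule ℝ (X → ℝ)) [FiniteDimensional ℝ H] (μ : Measure X)
    (hL : ∀ f ∈ H, MemLp f 2 μ) (hnd : IsNondegenerateOn H μ) :
    IsReproducingKernel H μ (reproducingKernel H μ) :=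
  Classical.epsilon_spec (existsUnique_isReproducingKernel H μ hL hnd).exists

instance polySpace_finiteDimensional {m : ℕ} (M : Set (EuclideanSpace ℝ (Fin m))) (k : ℕ) :
    FiniteDimensional ℝ (polySpace M k) := by
  unfold polySpace; infer_instance

theorem polySpace_continuous {m : ℕ} (M : Set (EuclideanSpace ℝ (Fin m))) (k : ℕ)
    {f : M → ℝ} (hf : f ∈ polySpace M k) : Continuous f := by
  obtain ⟨p, -, rfl⟩ := hf
  change Continuous fun x : M => MvPolynomial.eval x.1.ofLp p
  exact (MvPolynomial.continuous_eval p).comp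
    ((PiLp.continuous_ofLp 2 _).comp continuous_subtype_val)

theorem polySpace_memLp {m : ℕ} (M : Set (EuclideanSpace ℝ (Fin m))) (k : ℕ)
    (μ : Measure M) [IsFiniteMeasure μ] {S : Set M} (hS : IsCompact S) (hμ : μ.support ⊆ S)
    {f : M → ℝ} (hf : f ∈ polySpace M k) : MemLp f 2 μ := by
  have hc := polySpace_continuous M k hf
  obtain ⟨C, hC⟩ := hS.exists_bound_of_continuousOn hc.continuousOn
  refine MemLp.of_bound hc.aestronglyMeasurable C ?_
  filter_upwards [Measure.support_mem_ae (μ := μ)] with x hx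
  exact hC x (hμ hx)

/-- The kernel `K_k` of `H_k(M) ⊆ L²(M, μ)` exists (and `reproducingKernel` is that kernel) for a
non-degenerate finite measure `μ` with support in a compact subset of `M`. -/
theorem polySpace_reproducingKernel_spec {m : ℕ} (M : Set (EuclideanSpace ℝ (Fin m))) (k : ℕ)
    (μ : Measure M) [IsFiniteMeasure μ] {S : Set M} (hS : IsCompact S) (hμ : μ.support ⊆ S)
    (hnd : IsNondegenerateOn (polySpace M k) μ) :
    IsReproducingKernel (polySpace M k) μ (reproducingKernel (polySpace M k) μ) :=
  reproducingKernel_spec _ μ (fun _ hf => polySpace_memLp M k μ hS hμ hf) hnd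

end

/-! ### Filtered Noether normalisation and growth of the Hilbert function -/

section FilteredReduction

open MvPolynomial

/-! For a coordinate function `φ`, expanding the kernel in an orthonormal basis `e i` of `H_k` turns
the integral of `K² (φ x - φ y)²` into `2 ∑ i, (‖φ e i‖² - ∑ j, ⟨φ e i, e j⟩²)`, that is, twice the
sum of the squared distances of the `φ e i` from `H_k`. If the basis extends one of `H_{k-1}`, the
terms with `e i ∈ H_{k-1}` vanish, since `φ e i ∈ H_k`. Each other term is at most `2R²`, where `R`
bounds the norm on the compact set `S`. Hence the moment is at most `2R² (dim H_k - dim H_{k-1})`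
(`integral_reproducingKernel_sq_mul_sub_sq_le`), and summing over coordinates gives `|x - y|²`.

It remains to see that `dim H_k - dim H_{k-1} = O(k^(n-1))`. In the coordinate ring, `H_k` is `E ^
k`, with `E` the classes of polynomials of degree at most 1. Take the fewest elements `y` of `E`
whose span `W` satisfies `E^(D+1) ≤ E^D + W E^D` for some `D`. Minimality forces algebraic
independence, and the ring is finite over `K[y]`, so there are `r ≤ n` of them. Iterating gives
`E^(D+j+1) ≤ E^(D+j) + W^(j+1) E^D`, so the increment is at most the number of degree `j + 1`
monomials in `r` variables times `dim E^D`. -/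

theorem pow_succ_le_of_le {S : Type*} [IdemCommSemiring S] {x z : S} {k : ℕ}
    (h : x ^ (k + 1) ≤ x ^ k + z * x ^ k) (j : ℕ) (hj : k ≤ j) :
    x ^ (j + 1) ≤ x ^ j + z * x ^ j := by
  obtain ⟨i, rfl⟩ := Nat.exists_eq_add_of_le hj
  calc x ^ (k + i + 1) = x ^ (k + 1) * x ^ i := by ring
    _ ≤ (x ^ k + z * x ^ k) * x ^ i := by gcongr
    _ = _ := by ring

/-- With `x` a filtration step, `x ^ (k + j)` collects lower-order terms. Modulo these and multiples
of `z`, each new degree arises only by multiplying by `u` once more; `u ≤ x` absorbs the error terms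
at each step. -/
theorem pow_add_succ_le_of_le {S : Type*} [IdemCommSemiring S] {x z u : S} {k : ℕ}
    (hu : u ≤ x) (h : x ^ (k + 1) ≤ x ^ k + (z + u) * x ^ k) (j : ℕ) :
    x ^ (k + j + 1) ≤ x ^ (k + j) + z * x ^ (k + j) + u ^ (j + 1) * x ^ k := by
  induction j with
  | zero => simpa [add_mul, add_assoc] using h
  | succ j ih =>
    calc x ^ (k + (j + 1) + 1)
        ≤ x ^ (k + (j + 1)) + (z + u) * x ^ (k + (j + 1)) :=
          pow_succ_le_of_le h _ (by omega)
      _ = x ^ (k + (j + 1)) + z * x ^ (k + (j + 1)) + u * x ^ (k + j + 1) := by ring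
      _ ≤ x ^ (k + (j + 1)) + z * x ^ (k + (j + 1)) +
            u * (x ^ (k + j) + z * x ^ (k + j) + u ^ (j + 1) * x ^ k) := by gcongr
      _ = x ^ (k + (j + 1)) + z * x ^ (k + (j + 1)) +
            (u * x ^ (k + j) + z * (u * x ^ (k + j)) + u ^ (j + 1 + 1) * x ^ k) := by ring
      _ ≤ x ^ (k + (j + 1)) + z * x ^ (k + (j + 1)) +
            (x * x ^ (k + j) + z * (x * x ^ (k + j)) + u ^ (j + 1 + 1) * x ^ k) := by gcongr
      _ = (x ^ (k + (j + 1)) + x ^ (k + (j + 1))) +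
            (z * x ^ (k + (j + 1)) + z * x ^ (k + (j + 1))) + u ^ (j + 1 + 1) * x ^ k := by ring
      _ = _ := by simp only [add_idem]

/-- `hue` is an integral equation for `u` over `z` in the associated graded algebra, so high powers
of `u` are redundant and `u` can be dropped as a generator at the cost of raising the degree by `e`.
-/
theorem pow_succ_le_of_pow_le {S : Type*} [IdemCommSemiring S] {x z u : S} {k e : ℕ}
    (hu : u ≤ x) (h : x ^ (k + 1) ≤ x ^ k + (z + u) * x ^ k)
    (hue : u ^ (e + 1) ≤ x ^ e + z * x ^ e) :
    x ^ (k + e + 1) ≤ x ^ (k + e) + z * x ^ (k + e) := by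
  calc _ ≤ x ^ (k + e) + z * x ^ (k + e) + u ^ (e + 1) * x ^ k := pow_add_succ_le_of_le hu h e
    _ ≤ x ^ (k + e) + z * x ^ (k + e) + (x ^ e + z * x ^ e) * x ^ k := by gcongr
    _ = (x ^ (k + e) + z * x ^ (k + e)) + (x ^ (k + e) + z * x ^ (k + e)) := by ring
    _ = _ := add_idem _

variable {K A : Type*} [Field K] [CommRing A] [Algebra K A]

theorem Submodule.finrank_mul_le (V W : Submodule K A) [FiniteDimensional K V]
    [FiniteDimensional K W] :
    Module.finrank K ↥(V * W) ≤ Module.finrank K V * Module.finrank K W := by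
  rw [← Module.finrank_tensorProduct, ← Submodule.mulMap_range]
  exact LinearMap.finrank_range_le _

theorem finrank_span_range_pow_le {r : ℕ} (y : Fin r → A) (j : ℕ) :
    Module.finrank K ↥(Submodule.span K (Set.range y) ^ j) ≤ Nat.multichoose r j := by
  have hle : Submodule.span K (Set.range y) ^ j ≤
      Submodule.span K (Set.range fun s : Sym (Fin r) j => (s.1.map y).prod) := by
    rw [Submodule.span_pow]
    refine Submodule.span_mono ?_
    intro a ha
    obtain ⟨f, rfl⟩ := Set.mem_pow.1 ha
    choose g hg using fun i => (f i).2
    refine ⟨⟨(List.ofFn g : Multiset (Fin r)), by simp⟩, ?_⟩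
    simp [List.map_ofFn, Function.comp_def, hg]
  have hfin : FiniteDimensional K
      ↥(Submodule.span K (Set.range fun s : Sym (Fin r) j => (s.1.map y).prod)) :=
    FiniteDimensional.span_of_finite K (Set.finite_range _)
  refine (Submodule.finrank_mono hle).trans ?_
  refine (finrank_range_le_card (R := K) (fun s : Sym (Fin r) j => (s.1.map y).prod)).trans ?_
  rw [Sym.card_sym_eq_multichoose, Fintype.card_fin]

theorem Nat.multichoose_succ_le_pow (s j : ℕ) : Nat.multichoose (s + 1) j ≤ (j + 1) ^ s := by
  induction s generalizing j with
  | zero => simp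
  | succ s ih =>
    induction j with
    | zero => simp
    | succ j ihj =>
      rw [Nat.multichoose_succ_succ]
      calc _ ≤ (j + 1 + 1) ^ s + (j + 1) ^ s * (j + 1) := add_le_add (ih _) ihj
        _ ≤ (j + 1 + 1) ^ s + (j + 1 + 1) ^ s * (j + 1) := by gcongr; omega
        _ = _ := by ring

theorem MvPolynomial.IsHomogeneous.aeval_mem_pow {σ : Type*} {E : Submodule K A} {y : σ → A}
    (hy : ∀ i, y i ∈ E) {f : MvPolynomial σ K} {d : ℕ} (hf : f.IsHomogeneous d) :
    MvPolynomial.aeval y f ∈ E ^ d := by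
  have h : f ∈ homogeneousSubmodule σ K 1 ^ d := by
    rw [homogeneousSubmodule_one_pow]; exact hf
  have h1 : (homogeneousSubmodule σ K 1).map (MvPolynomial.aeval y).toLinearMap ≤ E := by
    rw [homogeneousSubmodule_one_eq_span_X, Submodule.map_span_le]
    rintro _ ⟨i, rfl⟩
    simpa using hy i
  have h2 := Submodule.mem_map_of_mem (f := (MvPolynomial.aeval y).toLinearMap) h
  rw [Submodule.map_pow] at h2
  exact pow_le_pow_left' h1 d h2

/-- Modulo `Z` every `y i` is the multiple `t i • u` of one element, so a form evaluates to its
value at `t` times a power of `u`. The error is tracked in the filtration, by induction through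
products with linear forms. -/
theorem MvPolynomial.IsHomogeneous.aeval_sub_mem {σ : Type*} {E Z : Submodule K A}
    {y : σ → A} (hy : ∀ i, y i ∈ E) {u : A} (hu : u ∈ E) {t : σ → K}
    (hz : ∀ i, y i - t i • u ∈ Z) {f : MvPolynomial σ K} {d : ℕ}
    (hf : f.IsHomogeneous (d + 1)) :
    MvPolynomial.aeval y f - eval t f • u ^ (d + 1) ∈ Z * E ^ d := by
  have key1 : ∀ f : MvPolynomial σ K, f.IsHomogeneous 1 →
      MvPolynomial.aeval y f - eval t f • u ∈ Z := by
    intro f hf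
    have h : f ∈ Submodule.span K (Set.range X) := by
      rw [← homogeneousSubmodule_one_eq_span_X]; exact hf
    induction h using Submodule.span_induction with
    | mem x h => obtain ⟨i, rfl⟩ := h; simpa using hz i
    | zero => simp
    | add p q hp hq h1 h2 =>
      rw [← homogeneousSubmodule_one_eq_span_X] at hp hq
      convert Z.add_mem (h1 hp) (h2 hq) using 1
      simp [add_smul]; ring
    | smul c p hp h1 =>
      rw [← homogeneousSubmodule_one_eq_span_X] at hp
      convert Z.smul_mem c (h1 hp) using 1
      simp [smul_sub, mul_smul, smul_eval]
  induction d generalizing f with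
  | zero => simpa using key1 f hf
  | succ d ih =>
    have h : f ∈ homogeneousSubmodule σ K 1 * homogeneousSubmodule σ K (d + 1) := by
      have h := homogeneousSubmodule_one_pow (σ := σ) (R := K) (d + 1)
      rw [← h, ← pow_succ', homogeneousSubmodule_one_pow]
      exact hf
    clear hf
    induction h using Submodule.mul_induction_on' with
    | mem_mul_mem l hl g hg =>
      have e : MvPolynomial.aeval y (l * g) - eval t (l * g) • u ^ (d + 1 + 1) =
          (MvPolynomial.aeval y l - eval t l • u) * MvPolynomial.aeval y g +
          eval t l • (u * (MvPolynomial.aeval y g - eval t g • u ^ (d + 1))) := by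
        simp only [map_mul, Algebra.smul_def]; ring
      rw [e]
      refine Submodule.add_mem _ (Submodule.mul_mem_mul (key1 l hl) (hg.aeval_mem_pow hy))
        (Submodule.smul_mem _ _ ?_)
      have := Submodule.mul_mem_mul hu (ih hg)
      rwa [mul_left_comm, ← pow_succ'] at this
    | add p _ q _ h1 h2 =>
      convert Submodule.add_mem _ h1 h2 using 1
      simp [add_smul]; ring

theorem MvPolynomial.homogeneousComponent_totalDegree_ne_zero {σ : Type*}
    {f : MvPolynomial σ K} (hf : f ≠ 0) : homogeneousComponent f.totalDegree f ≠ 0 := by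
  obtain ⟨s, hs, hd⟩ := Finset.exists_mem_eq_sup f.support (by simpa using hf)
    fun s => s.sum fun _ e => e
  intro h
  have := congrArg (coeff s) h
  rw [coeff_homogeneousComponent, if_pos] at this
  · simp at this; simp [this] at hs
  · exact hd.symm

/-- A nontrivial relation among `r + 1` elements that generate the associated graded algebra of
the filtration `E ^ k` up to finitely many degrees allows one to replace them by `r` elements. -/
theorem exists_filtered_reduction_of_relation [Infinite K] [Nontrivial A] {E : Submodule K A}
    (hE : 1 ≤ E) {r : ℕ} {y : Fin (r + 1) → A} (hy : ∀ i, y i ∈ E)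
    (hk : ∃ k, E ^ (k + 1) ≤ E ^ k + Submodule.span K (Set.range y) * E ^ k)
    {f : MvPolynomial (Fin (r + 1)) K} (hf : f ≠ 0) (hfy : aeval y f = 0) :
    ∃ z : Fin r → A, (∀ i, z i ∈ E) ∧
      ∃ k, E ^ (k + 1) ≤ E ^ k + Submodule.span K (Set.range z) * E ^ k := by
  obtain ⟨k, hk⟩ := hk
  -- A relation of degree 0 would be a nonzero constant equal to zero in the nontrivial ring `A`.
  obtain ⟨e, he⟩ : ∃ e, f.totalDegree = e + 1 := by
    refine Nat.exists_eq_succ_of_ne_zero fun h0 => ?_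
    rw [totalDegree_eq_zero_iff_eq_C] at h0
    rw [h0, aeval_C, map_eq_zero_iff _ (algebraMap K A).injective] at hfy
    rw [hfy, C_0] at h0
    exact hf h0
  set g := homogeneousComponent (e + 1) f with hg
  have hg0 : g ≠ 0 := by rw [hg, ← he]; exact homogeneousComponent_totalDegree_ne_zero hf
  have hgh : g.IsHomogeneous (e + 1) := homogeneousComponent_isHomogeneous _ _
  -- A nonzero form over an infinite field has a point `t` where it does not vanish; homogeneity in
  -- positive degree then gives `t ≠ 0`.
  obtain ⟨t, ht⟩ : ∃ t, eval t g ≠ 0 := by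
    by_contra! h
    exact hg0 (MvPolynomial.funext fun t => by simpa using h t)
  obtain ⟨i, hi⟩ : ∃ i, t i ≠ 0 := by
    by_contra! h
    have : t = 0 := by ext i; exact h i
    rw [this] at ht
    refine ht ?_
    change eval (fun _ => 0) g = 0
    rw [eval_zero']
    exact hgh.coeff_eq_zero (by simp)
  -- Normalised so that `y i - t i • u = 0`: the differences `y j - t j • u` then leave only `r` new
  -- generators.
  set u : A := (t i)⁻¹ • y i with hu
  have huE : u ∈ E := E.smul_mem _ (hy i)
  set z : Fin r → A := fun j => y (i.succAbove j) - t (i.succAbove j) • u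
  set Z := Submodule.span K (Set.range z)
  have hz : ∀ j, y j - t j • u ∈ Z := by
    intro j
    rcases Fin.eq_self_or_eq_succAbove i j with rfl | ⟨j, rfl⟩
    · rw [hu, smul_inv_smul₀ hi, sub_self]; exact Z.zero_mem
    · exact Submodule.subset_span ⟨j, rfl⟩
  have hW : Submodule.span K (Set.range y) ≤ Z + Submodule.span K {u} := by
    rw [Submodule.span_le]
    rintro _ ⟨j, rfl⟩
    rw [SetLike.mem_coe, Submodule.add_eq_sup, Submodule.mem_sup]
    exact ⟨_, hz j, t j • u, Submodule.smul_mem _ _ (Submodule.mem_span_singleton_self u), by simp⟩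
  refine ⟨z, fun j => E.sub_mem (hy _) (E.smul_mem _ huE), k + e, ?_⟩
  refine pow_succ_le_of_pow_le (u := Submodule.span K {u}) ?_ (hk.trans (by gcongr)) ?_
  · simpa using huE
  rw [Submodule.span_pow, Set.singleton_pow, Submodule.span_singleton_le_iff_mem]
  have hsum : g + ∑ j ∈ Finset.range (e + 1), homogeneousComponent j f = f := by
    have := sum_homogeneousComponent f
    rw [he, Finset.sum_range_succ] at this
    exact (add_comm _ _).trans this
  have hrest : aeval y (∑ j ∈ Finset.range (e + 1), homogeneousComponent j f) ∈ E ^ e := by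
    rw [map_sum]
    refine Submodule.sum_mem _ fun j hj => ?_
    exact pow_le_pow_right' hE (Finset.mem_range_succ_iff.1 hj)
      ((homogeneousComponent_isHomogeneous j f).aeval_mem_pow hy)
  -- The relation `f(y) = 0` trades the leading form for terms of lower degree, which makes `u`
  -- integral.
  have hgy : aeval y g ∈ E ^ e := by
    rw [← hsum, map_add] at hfy
    rw [eq_neg_of_add_eq_zero_left hfy]
    exact Submodule.neg_mem _ hrest
  have := Submodule.sub_mem_sup hgy (hgh.aeval_sub_mem hy huE hz)
  rw [sub_sub_cancel] at this
  rwa [Submodule.smul_mem_iff _ ht] at this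

/-- Lying over supplies a prime above the head of a chain, and going up lifts the rest. -/
theorem ringKrullDim_le_of_isIntegral_of_injective {R S : Type*} [CommRing R] [CommRing S]
    [Algebra R S] [Algebra.IsIntegral R S] (h : Function.Injective (algebraMap R S)) :
    ringKrullDim R ≤ ringKrullDim S := by
  refine iSup_le fun l => ?_
  obtain ⟨Q, -, hQ, hQl⟩ := Ideal.exists_ideal_over_prime_of_isIntegral
    l.head.asIdeal (⊥ : Ideal S) (by
      rw [Ideal.comap_bot_of_injective _ h]; exact bot_le)
  have : Q.LiesOver l.head.asIdeal := ⟨hQl.symm⟩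
  obtain ⟨L, hL, -⟩ := Ideal.exists_ltSeries_of_hasGoingUp l Q
  rw [← hL]
  exact le_iSup (fun L : LTSeries (PrimeSpectrum S) => (L.length : WithBot ℕ∞)) L

/-- The containment `hk` shows that `E ^ k` generates `A` as a module over the polynomial ring in
`y`, so `A` is a finite extension of a ring of dimension `r`. -/
theorem card_le_ringKrullDim_of_algebraicIndependent {E : Submodule K A} (hE : 1 ≤ E)
    (hfg : E.FG)
    (htop : ∀ a, ∃ j, a ∈ E ^ j) {r : ℕ} {y : Fin r → A}
    (hk : ∃ k, E ^ (k + 1) ≤ E ^ k + Submodule.span K (Set.range y) * E ^ k)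
    (hy : AlgebraicIndependent K y) : (r : WithBot ℕ∞) ≤ ringKrullDim A := by
  obtain ⟨k, hk⟩ := hk
  let _ : Algebra (MvPolynomial (Fin r) K) A := (aeval y).toAlgebra
  have hmap : ∀ p : MvPolynomial (Fin r) K, algebraMap _ A p = aeval y p := fun _ => rfl
  have : IsScalarTower K (MvPolynomial (Fin r) K) A := IsScalarTower.of_algHom (aeval y)
  set N := Submodule.span (MvPolynomial (Fin r) K) ((E ^ k : Submodule K A) : Set A) with hN
  have hsub : ∀ j, E ^ (k + j) ≤ N.restrictScalars K := by
    intro j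
    induction j with
    | zero => exact fun a ha => Submodule.subset_span ha
    | succ j ih =>
      refine (pow_succ_le_of_le hk (k + j) (by omega)).trans ?_
      rw [Submodule.add_eq_sup]
      refine sup_le ih (Submodule.mul_le.2 fun w hw a ha => ?_)
      induction hw using Submodule.span_induction with
      | mem x h =>
        obtain ⟨i, rfl⟩ := h
        have := N.smul_mem (X i) (ih ha)
        rwa [Algebra.smul_def, hmap, aeval_X] at this
      | zero => simp
      | add p q _ _ h1 h2 => rw [add_mul]; exact Submodule.add_mem _ h1 h2
      | smul c p _ h1 => rw [smul_mul_assoc]; exact Submodule.smul_mem _ c h1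
  have hNtop : N = ⊤ := by
    refine eq_top_iff.2 fun a _ => ?_
    obtain ⟨j, hj⟩ := htop a
    exact hsub j (pow_le_pow_right' hE (Nat.le_add_left j k) hj)
  have hNfg : N.FG := by
    obtain ⟨s, hs⟩ := hfg.pow k
    refine ⟨s, ?_⟩
    rw [hN, ← hs, Submodule.span_span_of_tower]
  have : Module.Finite (MvPolynomial (Fin r) K) A := ⟨hNtop ▸ hNfg⟩
  have hdim := ringKrullDim_le_of_isIntegral_of_injective (R := MvPolynomial (Fin r) K) (S := A) hy
  simpa [MvPolynomial.ringKrullDim_of_isNoetherianRing] using hdim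

theorem exists_filtered_reduction_card_le_ringKrullDim [Infinite K] [Nontrivial A]
    {E : Submodule K A} (hE : 1 ≤ E) (hfg : E.FG) (htop : ∀ a, ∃ j, a ∈ E ^ j) :
    ∃ (r : ℕ) (y : Fin r → A), (r : WithBot ℕ∞) ≤ ringKrullDim A ∧ (∀ i, y i ∈ E) ∧
      ∃ k, E ^ (k + 1) ≤ E ^ k + Submodule.span K (Set.range y) * E ^ k := by
  classical
  have hex : ∃ (r : ℕ) (y : Fin r → A), (∀ i, y i ∈ E) ∧
      ∃ k, E ^ (k + 1) ≤ E ^ k + Submodule.span K (Set.range y) * E ^ k := by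
    obtain ⟨r, y, hy⟩ := Submodule.fg_iff_exists_fin_generating_family.1 hfg
    -- A spanning family of `E` itself works with `k = 0`, so a minimal `r` exists.
    refine ⟨r, y, fun i => hy ▸ Submodule.subset_span ⟨i, rfl⟩, 0, ?_⟩
    rw [hy]
    simp
  obtain ⟨y, hy, hk⟩ := Nat.find_spec hex
  refine ⟨Nat.find hex, y, card_le_ringKrullDim_of_algebraicIndependent hE hfg htop hk ?_, hy, hk⟩
  have hmin := fun r => Nat.find_min (m := r) hex
  generalize Nat.find hex = r at y hy hk hmin
  cases r with
  | zero => exact algebraicIndependent_empty_type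
  | succ r =>
    rw [algebraicIndependent_iff]
    intro f hfy
    by_contra hf
    exact hmin r r.lt_succ_self (exists_filtered_reduction_of_relation hE hy hk hf hfy)

/-- The first difference of the Hilbert function of a filtered algebra `A = ⋃ E ^ k` of Krull
dimension `n` is `O(k ^ (n - 1))`, and eventually zero if `n = 0`. -/
theorem exists_mul_finrank_pow_le [Infinite K] {E : Submodule K A} (hE : 1 ≤ E) (hfg : E.FG)
    (htop : ∀ a, ∃ j, a ∈ E ^ j) {n : ℕ} (hn : ringKrullDim A = n) :
    ∃ C : ℕ, ∀ k, k * Module.finrank K ↥(E ^ k) ≤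
      C * k ^ n + k * Module.finrank K ↥(E ^ (k - 1)) := by
  have : Nontrivial A := by
    by_contra h
    rw [not_nontrivial_iff_subsingleton] at h
    rw [ringKrullDim_eq_bot_of_subsingleton] at hn
    exact absurd hn (by simp)
  obtain ⟨r, y, hr, hy, D, hD⟩ := exists_filtered_reduction_card_le_ringKrullDim hE hfg htop
  have hrn : r ≤ n := by rw [hn] at hr; exact_mod_cast hr
  have hfin : ∀ j, FiniteDimensional K ↥(E ^ j) := fun j =>
    (Submodule.fg_iff_finiteDimensional _).1 (hfg.pow j)
  have hWE : Submodule.span K (Set.range y) ≤ E := by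
    rw [Submodule.span_le]; rintro _ ⟨i, rfl⟩; exact hy i
  set W := Submodule.span K (Set.range y)
  have hWfin : ∀ j, FiniteDimensional K ↥(W ^ j) := fun j =>
    (Submodule.fg_iff_finiteDimensional _).1 ((Submodule.fg_span (Set.finite_range y)).pow j)
  have hWEfin : ∀ j, FiniteDimensional K ↥(W ^ j * E ^ D) := fun j =>
    (Submodule.fg_iff_finiteDimensional _).1
      (((Submodule.fg_span (Set.finite_range y)).pow j).mul (hfg.pow D))
  set N := Module.finrank K ↥(E ^ D)
  have hstep : ∀ j, Module.finrank K ↥(E ^ (D + j + 1)) ≤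
      Module.finrank K ↥(E ^ (D + j)) + Nat.multichoose r (j + 1) * N := by
    intro j
    -- With `z = 0` and `u = W`, all of `W` plays the role of the iterated factor.
    have h := pow_add_succ_le_of_le (z := 0) hWE (by simpa using hD) j
    rw [zero_mul, add_zero, Submodule.add_eq_sup] at h
    calc _ ≤ Module.finrank K ↥(E ^ (D + j) ⊔ W ^ (j + 1) * E ^ D) := Submodule.finrank_mono h
      _ ≤ _ := Submodule.finrank_add_le_finrank_add_finrank _ _
      _ ≤ _ := by
        gcongr
        refine (Submodule.finrank_mul_le _ _).trans ?_
        gcongr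
        exact finrank_span_range_pow_le y (j + 1)
  -- `D * N` covers `k ≤ D` by monotonicity, and `2 ^ r * N` covers `k > D`. Multiplying through by
  -- `k` avoids the exponent `n - 1`, so `n = 0` needs no separate statement.
  refine ⟨D * N + 2 ^ r * N, fun k => ?_⟩
  rcases Nat.eq_zero_or_pos k with rfl | hk
  · simp
  rcases le_or_gt k D with hkD | hkD
  · refine le_add_right ?_
    calc k * Module.finrank K ↥(E ^ k) ≤ D * N :=
          Nat.mul_le_mul hkD (Submodule.finrank_mono (pow_le_pow_right' hE hkD))
      _ ≤ (D * N + 2 ^ r * N) * 1 := by omega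
      _ ≤ _ := by gcongr; exact Nat.one_le_pow _ _ hk
  · obtain ⟨j, rfl⟩ := Nat.exists_eq_add_of_lt hkD
    have hmul : (D + j + 1) * Nat.multichoose r (j + 1) ≤ 2 ^ r * (D + j + 1) ^ n := by
      cases r with
      | zero => simp
      | succ s =>
        calc (D + j + 1) * Nat.multichoose (s + 1) (j + 1)
            ≤ (D + j + 1) * (2 * (D + j + 1)) ^ s := by
              gcongr
              refine (Nat.multichoose_succ_le_pow s (j + 1)).trans ?_
              gcongr; omega
          _ = 2 ^ s * (D + j + 1) ^ (s + 1) := by rw [mul_pow]; ring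
          _ ≤ 2 ^ (s + 1) * (D + j + 1) ^ n := by
              gcongr <;> omega
    calc _ ≤ (D + j + 1) * (Module.finrank K ↥(E ^ (D + j)) + Nat.multichoose r (j + 1) * N) := by
          gcongr; exact hstep j
      _ = (D + j + 1) * Nat.multichoose r (j + 1) * N +
            (D + j + 1) * Module.finrank K ↥(E ^ (D + j)) := by ring
      _ ≤ 2 ^ r * (D + j + 1) ^ n * N +
            (D + j + 1) * Module.finrank K ↥(E ^ (D + j)) := by gcongr
      _ ≤ _ := by
          rw [Nat.add_sub_cancel]
          rw [mul_right_comm]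
          gcongr
          exact Nat.le_add_left _ _

end FilteredReduction

/-! ### Restricted polynomials as a filtration of the coordinate ring -/

section Hilbert

open MvPolynomial

theorem restrictTotalDegree_one_pow (σ R : Type*) [CommRing R] [Nontrivial R] (k : ℕ) :
    restrictTotalDegree σ R 1 ^ k = restrictTotalDegree σ R k := by
  have h1 : (1 : Submodule R (MvPolynomial σ R)) ≤ restrictTotalDegree σ R 1 := by
    rw [Submodule.one_le, mem_restrictTotalDegree]
    simp
  refine le_antisymm ?_ fun p hp => ?_
  · induction k with
    | zero =>
      rw [pow_zero, Submodule.one_le, mem_restrictTotalDegree]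
      simp
    | succ k ih =>
      rw [pow_succ]
      refine Submodule.mul_le.2 fun p hp q hq => ?_
      have hp := ih hp
      rw [mem_restrictTotalDegree] at *
      exact (totalDegree_mul p q).trans (add_le_add hp hq)
  · rw [mem_restrictTotalDegree] at hp
    rw [← sum_homogeneousComponent p]
    refine Submodule.sum_mem _ fun j hj => ?_
    refine pow_le_pow_right' h1 ((Finset.mem_range_succ_iff.1 hj).trans hp) ?_
    have := homogeneousComponent_mem j p
    rw [← homogeneousSubmodule_one_pow] at this
    have hle : homogeneousSubmodule σ R 1 ≤ restrictTotalDegree σ R 1 := fun q hq => by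
      rw [mem_restrictTotalDegree]
      exact IsHomogeneous.totalDegree_le hq
    exact pow_le_pow_left' hle j this

variable {m : ℕ} (M : Set (EuclideanSpace ℝ (Fin m)))

theorem polySpace_mono {k l : ℕ} (h : k ≤ l) : polySpace M k ≤ polySpace M l := by
  refine Submodule.map_mono fun p hp => ?_
  rw [mem_restrictTotalDegree] at *
  exact hp.trans h

theorem coord_mul_mem_polySpace (i : Fin m) (k : ℕ) {f : M → ℝ} (hf : f ∈ polySpace M k) :
    (fun x => x.1.ofLp i * f x) ∈ polySpace M (k + 1) := by
  obtain ⟨p, hp, rfl⟩ := hf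
  refine ⟨X i * p, ?_, ?_⟩
  · rw [SetLike.mem_coe, mem_restrictTotalDegree] at *
    refine (totalDegree_mul _ _).trans ?_
    rw [totalDegree_X]; omega
  · ext x
    simp [restrictPoly]

/-- The image of the polynomials of degree at most `1` in the coordinate ring. -/
noncomputable def coordinateRingDegreeOne : Submodule ℝ (RealCoordinateRing M) :=
  (restrictTotalDegree (Fin m) ℝ 1).map (Ideal.Quotient.mkₐ ℝ _).toLinearMap

theorem coordinateRingDegreeOne_pow (k : ℕ) : coordinateRingDegreeOne M ^ k =
    (restrictTotalDegree (Fin m) ℝ k).map (Ideal.Quotient.mkₐ ℝ _).toLinearMap := by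
  rw [coordinateRingDegreeOne, ← Submodule.map_pow, restrictTotalDegree_one_pow]

/-- Restriction to `M` has kernel exactly `I(M)`, so it embeds the coordinate ring in the functions
on `M` and carries `E ^ k` onto `H_k(M)`. -/
theorem finrank_coordinateRingDegreeOne_pow (k : ℕ) :
    Module.finrank ℝ ↥(coordinateRingDegreeOne M ^ k) = Module.finrank ℝ (polySpace M k) := by
  have hker : ∀ p, p ∈ vanishingIdeal ℝ (WithLp.ofLp '' M) ↔ restrictPoly M p = 0 := by
    intro p
    rw [mem_vanishingIdeal_iff, Set.forall_mem_image]
    simp [funext_iff, restrictPoly, aeval_eq_eval]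
  let φ : RealCoordinateRing M →ₗ[ℝ] (M → ℝ) :=
    Submodule.liftQ ((vanishingIdeal ℝ (WithLp.ofLp '' M)).restrictScalars ℝ) (restrictPoly M)
      fun p hp => (hker p).1 hp
  have hφ : Function.Injective φ := by
    rw [← LinearMap.ker_eq_bot]
    exact Submodule.ker_liftQ_eq_bot _ _ _ fun p hp => (hker p).2 hp
  have h : polySpace M k = (coordinateRingDegreeOne M ^ k).map φ := by
    rw [coordinateRingDegreeOne_pow, ← Submodule.map_comp]
    rfl
  rw [h]
  exact (Submodule.equivMapOfInjective φ hφ _).finrank_eq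

theorem exists_mul_finrank_polySpace_le {n : ℕ} (hn : HasVarietyDim M n) :
    ∃ C : ℕ, ∀ k, k * Module.finrank ℝ (polySpace M k) ≤
      C * k ^ n + k * Module.finrank ℝ (polySpace M (k - 1)) := by
  have hone : (1 : Submodule ℝ (RealCoordinateRing M)) ≤ coordinateRingDegreeOne M := by
    rw [Submodule.one_le]
    exact ⟨1, by rw [SetLike.mem_coe, mem_restrictTotalDegree]; simp,
      map_one (Ideal.Quotient.mkₐ ℝ _)⟩
  have hfg : (coordinateRingDegreeOne M).FG :=
    Submodule.FG.map _ ((Submodule.fg_iff_finiteDimensional _).2 inferInstance)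
  have htop : ∀ a, ∃ j, a ∈ coordinateRingDegreeOne M ^ j := by
    intro a
    obtain ⟨p, rfl⟩ := Ideal.Quotient.mk_surjective a
    refine ⟨p.totalDegree, ?_⟩
    rw [coordinateRingDegreeOne_pow]
    exact ⟨p, by rw [SetLike.mem_coe, mem_restrictTotalDegree], rfl⟩
  obtain ⟨C, hC⟩ := exists_mul_finrank_pow_le hone hfg htop hn
  exact ⟨C, fun k => by simpa only [finrank_coordinateRingDegreeOne_pow] using hC k⟩

end Hilbert

/-! ### Off-diagonal moments of reproducing kernels -/

section Kernel

/-- An orthonormal basis of `U` extends to one of `V`; only the added vectors can lie outside `U`.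
-/
theorem exists_orthonormal_basis_adapted {V : Type*} [AddCommGroup V] [Module ℝ V]
    [FiniteDimensional ℝ V] (B : V →ₗ[ℝ] V →ₗ[ℝ] ℝ) (hsymm : ∀ v w, B v w = B w v)
    (hnonneg : ∀ v, 0 ≤ B v v) (hdef : ∀ v, B v v = 0 → v = 0) (U : Submodule ℝ V) :
    ∃ e : Fin (Module.finrank ℝ V) → V, (∀ i j, B (e i) (e j) = if i = j then 1 else 0) ∧
      (∀ v, v = ∑ i, B v (e i) • e i) ∧
      {i | e i ∉ U}.ncard ≤ Module.finrank ℝ V - Module.finrank ℝ U := by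
  let core : InnerProductSpace.Core ℝ V :=
    { inner := fun v w => B v w
      conj_inner_symm := fun v w => hsymm w v
      re_inner_nonneg := hnonneg
      add_left := fun u v w => by simp
      smul_left := fun u v r => by simp
      definite := hdef }
  let _ : NormedAddCommGroup V := core.toNormedAddCommGroup
  let _ : InnerProductSpace ℝ V := InnerProductSpace.ofCore core.toCore
  have hin : ∀ v w : V, inner ℝ v w = B v w := fun _ _ => rfl
  have hUV : Module.finrank ℝ U ≤ Module.finrank ℝ V := U.finrank_le
  let b := stdOrthonormalBasis ℝ U
  let v : Fin (Module.finrank ℝ V) → V :=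
    fun i => if h : i.1 < Module.finrank ℝ U then (b ⟨i.1, h⟩ : V) else 0
  let s : Set (Fin (Module.finrank ℝ V)) := {i | i.1 < Module.finrank ℝ U}
  have hv : Orthonormal ℝ (s.domRestrict v) := by
    have h1 : Orthonormal ℝ (fun i => (b i : V)) :=
      b.orthonormal.comp_linearIsometry U.subtypeₗᵢ
    have h2 := h1.comp (fun i : s => (⟨i.1.1, i.2⟩ : Fin (Module.finrank ℝ U)))
      (fun i j h => by
        simp only [Fin.mk.injEq] at h
        exact Subtype.ext (Fin.ext h))
    convert h2 using 1
    ext i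
    exact dif_pos i.2
  obtain ⟨e, he⟩ := hv.exists_orthonormalBasis_extension_of_card_eq (by simp)
  refine ⟨e, fun i j => ?_, fun w => ?_, ?_⟩
  · rw [← hin, orthonormal_iff_ite.1 e.orthonormal]
  · conv_lhs => rw [← e.sum_repr' w]
    simp only [hin, hsymm w]
  · have hsub : {i | e i ∉ U} ⊆ sᶜ := by
      intro i hi his
      refine hi ?_
      rw [he i his]
      have : v i = b ⟨i.1, his⟩ := dif_pos his
      rw [this]
      exact (b _).2
    refine (Set.ncard_le_ncard hsub).trans ?_
    rw [Set.ncard_compl, Nat.card_eq_fintype_card, Fintype.card_fin]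
    refine Nat.sub_le_sub_left (le_of_eq ?_) _
    have : s = Set.range (Fin.castLE hUV) := by
      ext i; simp [s, Fin.range_castLE]
    rw [this, Set.ncard_range_of_injective (Fin.castLE_injective hUV)]
    simp

variable {X : Type*} [MeasurableSpace X]

theorem exists_orthonormal_functions (H H' : Submodule ℝ (X → ℝ)) [FiniteDimensional ℝ H]
    (hH' : H' ≤ H) (μ : Measure X) (hL : ∀ f ∈ H, MemLp f 2 μ) (hnd : IsNondegenerateOn H μ) :
    ∃ (N : ℕ) (e : Fin N → X → ℝ), (∀ i, e i ∈ H) ∧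
      (∀ i j, ∫ y, e i y * e j y ∂μ = if i = j then 1 else 0) ∧
      (∀ f ∈ H, f = ∑ i, (∫ y, f y * e i y ∂μ) • e i) ∧
      {i | e i ∉ H'}.ncard ≤ Module.finrank ℝ H - Module.finrank ℝ H' := by
  have hint : ∀ f ∈ H, ∀ g ∈ H, Integrable (fun y => f y * g y) μ :=
    fun f hf g hg => (hL f hf).integrable_mul (hL g hg)
  let B : H →ₗ[ℝ] (H →ₗ[ℝ] ℝ) := LinearMap.mk₂ ℝ (fun f g : H => ∫ y, f.1 y * g.1 y ∂μ)
    (by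
      intro f f' g
      rw [← integral_add (hint _ f.2 _ g.2) (hint _ f'.2 _ g.2)]
      simp [add_mul])
    (by
      intro c f g
      rw [smul_eq_mul, ← integral_const_mul]
      simp [mul_assoc])
    (by
      intro f g g'
      rw [← integral_add (hint _ f.2 _ g.2) (hint _ f.2 _ g'.2)]
      simp [mul_add])
    (by
      intro c f g
      rw [smul_eq_mul, ← integral_const_mul]
      simp [mul_left_comm])
  have hB : ∀ f g : H, B f g = ∫ y, f.1 y * g.1 y ∂μ := fun _ _ => rfl
  obtain ⟨e, he, hexp, hcard⟩ := exists_orthonormal_basis_adapted B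
    (fun f g => by simp only [hB, mul_comm])
    (fun f => integral_nonneg fun y => mul_self_nonneg _)
    (fun f h0 => by
      rw [hB] at h0
      by_contra hne
      refine hnd f.1 f.2 (fun h => hne (Subtype.ext h)) ?_
      rw [integral_eq_zero_iff_of_nonneg (fun y => mul_self_nonneg (f.1 y))
        (hint _ f.2 _ f.2)] at h0
      rw [eLpNorm_eq_zero_iff (hL _ f.2).1 two_ne_zero]
      filter_upwards [h0] with y hy
      simpa using hy)
    (H'.comap H.subtype)
  refine ⟨_, fun i => (e i).1, fun i => (e i).2, he, fun f hf => ?_, ?_⟩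
  · have := congrArg Subtype.val (hexp ⟨f, hf⟩)
    simpa [hB] using this
  · have h := (Submodule.comapSubtypeEquivOfLe hH').finrank_eq
    rw [← h]
    exact hcard

theorem reproducingKernel_eq_sum (H : Submodule ℝ (X → ℝ)) [FiniteDimensional ℝ H]
    (μ : Measure X) (hL : ∀ f ∈ H, MemLp f 2 μ) (hnd : IsNondegenerateOn H μ)
    {N : ℕ} {e : Fin N → X → ℝ} (he : ∀ i, e i ∈ H)
    (hexp : ∀ f ∈ H, f = ∑ i, (∫ y, f y * e i y ∂μ) • e i) (x y : X) :
    reproducingKernel H μ x y = ∑ i, e i x * e i y := by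
  have h : IsReproducingKernel H μ (fun x y => ∑ i, e i x * e i y) := by
    refine ⟨fun x => ?_, fun f hf x => ?_⟩
    · have : (fun y => ∑ i, e i y * e i x) = ∑ i, e i x • e i := by
        ext y; simp [mul_comm]
      rw [this]
      exact H.sum_mem fun i _ => H.smul_mem _ (he i)
    · conv_lhs => rw [hexp f hf]
      simp only [Finset.mul_sum, ← mul_assoc]
      have hint : ∀ i, Integrable (fun y => f y * e i y * e i x) μ := fun i =>
        ((hL f hf).integrable_mul (hL _ (he i))).mul_const _
      rw [integral_finsetSum _ fun i _ => hint i]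
      simp [integral_mul_const]
  rw [(existsUnique_isReproducingKernel H μ hL hnd).unique
    (reproducingKernel_spec H μ hL hnd) h]

/-- The off-diagonal second moment of the reproducing kernel of `H` in the direction of a bounded
function `φ` that multiplies `H' ⊆ H` into `H` is controlled by the codimension of `H'`. -/
theorem integral_reproducingKernel_sq_mul_sub_sq_le (H H' : Submodule ℝ (X → ℝ))
    [FiniteDimensional ℝ H] (hH' : H' ≤ H) (μ : Measure X) [IsFiniteMeasure μ]
    (hL : ∀ f ∈ H, MemLp f 2 μ) (hnd : IsNondegenerateOn H μ) {φ : X → ℝ} {R : ℝ}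
    (hφ : AEStronglyMeasurable φ μ) (hR : ∀ᵐ x ∂μ, |φ x| ≤ R)
    (hmul : ∀ f ∈ H', (fun x => φ x * f x) ∈ H) :
    Integrable (fun p : X × X => reproducingKernel H μ p.1 p.2 ^ 2 * (φ p.1 - φ p.2) ^ 2)
      (μ.prod μ) ∧
    ∫ p : X × X, reproducingKernel H μ p.1 p.2 ^ 2 * (φ p.1 - φ p.2) ^ 2 ∂(μ.prod μ) ≤
      2 * R ^ 2 * (Module.finrank ℝ H - Module.finrank ℝ H' : ℝ) := by
  obtain ⟨N, e, he, hort, hexp, hcard⟩ := exists_orthonormal_functions H H' hH' μ hL hnd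
  have hφL : ∀ f : X → ℝ, MemLp f 2 μ → MemLp (fun x => φ x * f x) 2 μ := fun f hf =>
    hf.mul' (p := ⊤) (memLp_top_of_bound hφ R (by simpa using hR))
  have hb0 : ∀ i j, Integrable (fun x => e i x * e j x) μ := fun i j =>
    (hL _ (he i)).integrable_mul (hL _ (he j))
  have hb1 : ∀ i j, Integrable (fun x => φ x * e i x * e j x) μ := fun i j =>
    (hφL _ (hL _ (he i))).integrable_mul (hL _ (he j))
  have hb2 : ∀ i j, Integrable (fun x => φ x * e i x * (φ x * e j x)) μ := fun i j =>
    (hφL _ (hL _ (he i))).integrable_mul (hφL _ (hL _ (he j)))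
  -- Expanding both squares separates the variables, so integrability and integrals reduce to
  -- one-variable products.
  have hpt : (fun p : X × X => reproducingKernel H μ p.1 p.2 ^ 2 * (φ p.1 - φ p.2) ^ 2) =
      fun p => ∑ i, ∑ j, ((φ p.1 * e i p.1 * (φ p.1 * e j p.1)) * (e i p.2 * e j p.2)
        - 2 * ((φ p.1 * e i p.1 * e j p.1) * (φ p.2 * e i p.2 * e j p.2))
        + (e i p.1 * e j p.1) * (φ p.2 * e i p.2 * (φ p.2 * e j p.2))) := by
    ext p
    rw [reproducingKernel_eq_sum H μ hL hnd he hexp, sq (∑ i, _), Finset.sum_mul_sum,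
      Finset.sum_mul]
    refine Finset.sum_congr rfl fun i _ => ?_
    rw [Finset.sum_mul]
    exact Finset.sum_congr rfl fun j _ => by ring
  have hi1 := fun i j => (hb2 i j).mul_prod (hb0 i j)
  have hi2 := fun i j => ((hb1 i j).mul_prod (hb1 i j)).const_mul 2
  have hi3 := fun i j => (hb0 i j).mul_prod (hb2 i j)
  have hterm : ∀ i j, Integrable (fun p : X × X =>
      (φ p.1 * e i p.1 * (φ p.1 * e j p.1)) * (e i p.2 * e j p.2)
        - 2 * ((φ p.1 * e i p.1 * e j p.1) * (φ p.2 * e i p.2 * e j p.2))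
        + (e i p.1 * e j p.1) * (φ p.2 * e i p.2 * (φ p.2 * e j p.2))) (μ.prod μ) :=
    fun i j => ((hi1 i j).sub (hi2 i j)).add (hi3 i j)
  rw [hpt]
  refine ⟨integrable_finsetSum _ fun i _ => integrable_finsetSum _ fun j _ => hterm i j, ?_⟩
  -- Orthonormality kills the off-diagonal part of the two outer terms, and these two agree by
  -- symmetry; this is the source of the factor 2.
  have hval : ∀ i j, ∫ p : X × X, ((φ p.1 * e i p.1 * (φ p.1 * e j p.1)) * (e i p.2 * e j p.2)
        - 2 * ((φ p.1 * e i p.1 * e j p.1) * (φ p.2 * e i p.2 * e j p.2))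
        + (e i p.1 * e j p.1) * (φ p.2 * e i p.2 * (φ p.2 * e j p.2))) ∂(μ.prod μ) =
      2 * (if i = j then ∫ x, φ x * e i x * (φ x * e i x) ∂μ else 0) -
        2 * (∫ x, φ x * e i x * e j x ∂μ) ^ 2 := by
    intro i j
    have := integral_add ((hi1 i j).sub (hi2 i j)) (hi3 i j)
    refine this.trans ?_
    have := integral_sub (hi1 i j) (hi2 i j)
    simp only [Pi.sub_apply]
    rw [this, integral_const_mul,
      integral_prod_mul (fun x => φ x * e i x * (φ x * e j x)) (fun x => e i x * e j x),
      integral_prod_mul (fun x => φ x * e i x * e j x) (fun x => φ x * e i x * e j x),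
      integral_prod_mul (fun x => e i x * e j x) (fun x => φ x * e i x * (φ x * e j x)), hort]
    split_ifs with h
    · subst h; ring
    · ring
  rw [integral_finsetSum _ fun i _ => integrable_finsetSum _ fun j _ => hterm i j]
  have hrow : ∀ i, ∫ p : X × X, ∑ j, ((φ p.1 * e i p.1 * (φ p.1 * e j p.1)) * (e i p.2 * e j p.2)
        - 2 * ((φ p.1 * e i p.1 * e j p.1) * (φ p.2 * e i p.2 * e j p.2))
        + (e i p.1 * e j p.1) * (φ p.2 * e i p.2 * (φ p.2 * e j p.2))) ∂(μ.prod μ) ≤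
      {i | e i ∉ H'}.indicator (fun _ => 2 * R ^ 2) i := by
    intro i
    rw [integral_finsetSum _ fun j _ => hterm i j]
    simp only [hval, Finset.sum_sub_distrib, ← Finset.mul_sum, Finset.sum_ite_eq,
      Finset.mem_univ, if_true]
    by_cases hi : e i ∈ H'
    · rw [Set.indicator_of_notMem (by simpa using hi)]
      have hf := hmul _ hi
      -- Parseval in `H`: since `φ * e i` stays in `H`, nothing is lost by projecting and the row is
      -- zero.
      have hpars : ∫ x, φ x * e i x * (φ x * e i x) ∂μ =
          ∑ j, (∫ x, φ x * e i x * e j x ∂μ) ^ 2 := by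
        have h1 : ∀ x, φ x * e i x = ∑ j, (∫ y, φ y * e i y * e j y ∂μ) * e j x := fun x => by
          simpa using congrFun (hexp _ hf) x
        calc _ = ∫ x, ∑ j, (∫ y, φ y * e i y * e j y ∂μ) * (φ x * e i x * e j x) ∂μ := by
              refine integral_congr_ae (Filter.Eventually.of_forall fun x => ?_)
              change φ x * e i x * (φ x * e i x) = _
              conv_lhs => enter [2]; rw [h1 x]
              rw [Finset.mul_sum]
              exact Finset.sum_congr rfl fun j _ => by ring
          _ = _ := by
              rw [integral_finsetSum _ fun j _ => (hb1 i j).const_mul _]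
              simp [integral_const_mul, sq]
      rw [hpars]; simp
    · rw [Set.indicator_of_mem (by simpa using hi)]
      have h1 : ∫ x, φ x * e i x * (φ x * e i x) ∂μ ≤ R ^ 2 := by
        calc _ ≤ ∫ x, R ^ 2 * (e i x * e i x) ∂μ := by
              refine integral_mono_ae (hb2 i i) ((hb0 i i).const_mul _) ?_
              filter_upwards [hR] with x hx
              have := sq_le_sq' (abs_le.1 hx).1 (abs_le.1 hx).2
              nlinarith [mul_le_mul_of_nonneg_right this (mul_self_nonneg (e i x))]
          _ = R ^ 2 := by rw [integral_const_mul, hort]; simp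
      have h2 : 0 ≤ ∑ j, (∫ x, φ x * e i x * e j x ∂μ) ^ 2 :=
        Finset.sum_nonneg fun j _ => sq_nonneg _
      linarith
  refine (Finset.sum_le_sum fun i _ => hrow i).trans ?_
  classical
  rw [Finset.sum_indicator_eq_sum_filter, Finset.sum_const, nsmul_eq_mul, mul_comm]
  refine mul_le_mul_of_nonneg_left ?_ (by positivity)
  rw [← Nat.cast_sub (Submodule.finrank_mono hH')]
  refine Nat.cast_le.2 (le_trans (le_of_eq ?_) hcard)
  rw [Set.ncard_eq_toFinset_card']
  congr 1
  ext i; simp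

end Kernel

/-! ### The main estimate -/

theorem mainTheorem9 {m : ℕ} (M : Set (EuclideanSpace ℝ (Fin m))) (hM : IsAffineRealVariety M)
    (n : ℕ) (hn : HasVarietyDim M n)
    (μ : ℕ → Measure M) [∀ k, IsFiniteMeasure (μ k)]
    (S : Set M) (hS : IsCompact S) (hμS : ∀ k, (μ k).support ⊆ S)
    (hμ : ∀ k, IsNondegenerateOn (polySpace M k) (μ k)) :
    ∃ C : ℝ, 0 < C ∧ ∀ k : ℕ, 1 ≤ k →
      Integrable (fun p : M × M => 1 / (k : ℝ) ^ n *
        |reproducingKernel (polySpace M k) (μ k) p.1 p.2| ^ 2 * ‖p.1.1 - p.2.1‖ ^ 2)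
        ((μ k).prod (μ k)) ∧
      ∫ p : M × M, 1 / (k : ℝ) ^ n *
        |reproducingKernel (polySpace M k) (μ k) p.1 p.2| ^ 2 * ‖p.1.1 - p.2.1‖ ^ 2
        ∂((μ k).prod (μ k)) ≤ C / k := by
  obtain ⟨D, hD⟩ := exists_mul_finrank_polySpace_le M hn
  obtain ⟨R, hR⟩ := hS.exists_bound_of_continuousOn
    (f := fun x : M => x.1) continuous_subtype_val.continuousOn
  -- `2 * R ^ 2` for each of the `m` coordinates, times the Hilbert constant `D`; the `+ 1` only
  -- ensures positivity.
  refine ⟨m * (2 * R ^ 2) * D + 1, by positivity, fun k hk => ?_⟩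
  set K := reproducingKernel (polySpace M k) (μ k)
  have hcoord := fun i : Fin m => integral_reproducingKernel_sq_mul_sub_sq_le
    (polySpace M k) (polySpace M (k - 1)) (polySpace_mono M (Nat.sub_le k 1)) (μ k)
    (fun f hf => polySpace_memLp M k (μ k) hS (hμS k) hf) (hμ k)
    (φ := fun x => x.1.ofLp i) (R := R)
    (Continuous.aestronglyMeasurable (by fun_prop))
    (by
      filter_upwards [Measure.support_mem_ae (μ := μ k)] with x hx
      exact (PiLp.norm_apply_le x.1 i).trans (hR x (hμS k hx)))
    (fun f hf => by
      have := coord_mul_mem_polySpace M i (k - 1) hf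
      rwa [Nat.sub_add_cancel hk] at this)
  have hpt : (fun p : M × M => 1 / (k : ℝ) ^ n * |K p.1 p.2| ^ 2 * ‖p.1.1 - p.2.1‖ ^ 2) =
      fun p => 1 / (k : ℝ) ^ n * ∑ i, K p.1 p.2 ^ 2 * (p.1.1.ofLp i - p.2.1.ofLp i) ^ 2 := by
    ext p
    rw [EuclideanSpace.norm_sq_eq, sq_abs, ← Finset.mul_sum, mul_assoc]
    simp
  rw [hpt]
  refine ⟨(integrable_finsetSum _ fun i _ => (hcoord i).1).const_mul _, ?_⟩
  rw [integral_const_mul, integral_finsetSum _ fun i _ => (hcoord i).1]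
  have hk0 : (0 : ℝ) < k := by exact_mod_cast hk
  have hdim : (k : ℝ) * (Module.finrank ℝ (polySpace M k) -
      Module.finrank ℝ (polySpace M (k - 1))) ≤ D * k ^ n := by
    have : (k : ℝ) * Module.finrank ℝ (polySpace M k) ≤
      D * k ^ n + k * Module.finrank ℝ (polySpace M (k - 1)) := by exact_mod_cast hD k
    linarith
  have hsum := Finset.sum_le_sum fun i (_ : i ∈ Finset.univ) => (hcoord i).2
  rw [Finset.sum_const, Finset.card_univ, Fintype.card_fin, nsmul_eq_mul] at hsum
  rw [one_div_mul_eq_div, div_le_div_iff₀ (by positivity) hk0]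
  calc _ ≤ (m * (2 * R ^ 2 * (Module.finrank ℝ (polySpace M k) -
          Module.finrank ℝ (polySpace M (k - 1)) : ℝ))) * k :=
        mul_le_mul_of_nonneg_right hsum hk0.le
    _ = m * (2 * R ^ 2) * (k * (Module.finrank ℝ (polySpace M k) -
          Module.finrank ℝ (polySpace M (k - 1)))) := by ring
    _ ≤ m * (2 * R ^ 2) * (D * k ^ n) := by gcongr
    _ ≤ _ := by nlinarith [pow_pos hk0 n]
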